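/- Let $K\ge 0$ and $J,N\ge 1$ be integers. Let $\mathbf S^{n}$ denote the symmetric real $n\times n$ matrices and $\mathbf S^n_+$ the positive semidefinite ones, and write $\langle (X,Y),(G,F)\rangle=\operatorname{tr}(X^TG)+Y^TF$ for $(X,Y),(G,F)\in\mathbf S^{K+2}\times\mathbf R^{K+1}$. Let $I=\{\star,0,1,\dots,K\}$ and $M=\{(i,j)\in I\times I : i\ne j\}$. Let $(A_m,b_m)$ for $m\in M$, $(A_0,b_0)$, and $(A^j_{\rm obj},b^j_{\rm obj})$ for $j=1,\dots,J$ be elements of $\mathbf S^{K+2}\times\mathbf R^{K+1}$, and let $c_0\in\mathbf R$ and $c^j_{\rm obj}\in\mathbf R$. Put $\mathcal S(Z)=(-\langle (A_m,b_m),Z\rangle)_{m\in M}$, with adjoint $\mathcal S^*(y)=-\sum_{m\in M}y_m(A_m,b_m)$, and $$\mathcal F=\{(G,F)\in\mathbf S^{K+2}_+\times\mathbf R^{K+1} : \mathcal S(G,F)\ge 0\},\qquad \mathcal X=\{(G,F)\in\mathbf S^{K+2}_+\times\mathbf R^{K+1} : \langle (A_0,b_0),(G,F)\rangle+c_0\le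 0\}.$$ Assume that $\mathcal F\cap\mathcal X$ is compact, and let $\widehat Z_1,\dots,\widehat Z_N\in\mathcal F\cap\mathcal X$ be samples with empirical distribution $\widehat{\mathbf P}=\frac1N\sum_{i=1}^N\delta_{\widehat Z_i}$. Let $D=(D_G,D_F)$ be a pair of positive definite diagonal matrices of sizes $K+2$ and $K+1$, write $D^{-1}=(D_G^{-1},D_F^{-1})$, and put $$\|(G,F)\|_D=\sqrt{\|D_G^{1/2}GD_G^{1/2}\|_{\rm Frob}^2+\|D_FF\|_2^2}.$$ For $\varepsilon>0$ let $\mathcal P_\varepsilon$ be the set of probability distributions $\mathbf Q$ supported on $\mathcal F\cap\mathcal X$ with $W(\widehat{\mathbf P},\mathbf Q)\le\varepsilon$, where $W$ is the type-1 Wasserstein distance with respect to $\|\cdot\|_D$. Let $\mathcal L$ be the set of the losses $\ell(Z)=\max_{1\le j\le J}\big(\langle (A^j_{\rm obj},b^j_{\rm obj}),Z\rangle+c^j_{\rm obj}t\big)$ with $t\in\mathbf R$. Then, as extended real numbers, $\sup_{\mathbf Q\in\mathcal P_\varepsilon}\inf_{\ell\in\mathcal L}\mathbf E_{Z\sim\mathbf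 Q}\,\ell(Z)$ is equal to the optimal value (infimum) of the problem $$\begin{array}{ll}\text{minimize}&\frac1N\sum_{i=1}^N s_i\\ \text{subject to}& c^j_{\rm obj}t-c_0\tau_i^j-\langle (X_i^j,Y_i^j),\widehat Z_i\rangle+\lambda\varepsilon\le s_i,\\ &-\mathcal S^*(y_i^j)-(X_i^j,Y_i^j)+\tau_i^j(A_0,b_0)-(A^j_{\rm obj},b^j_{\rm obj})\in\mathbf S^{K+2}_+\times\{0\},\\ &\|(X_i^j,Y_i^j)\|_{D^{-1}}\le\lambda,\qquad i=1,\dots,N,\ j=1,\dots,J,\end{array}$$ with variables $s_i,t\in\mathbf R$, $\tau_i^j,\lambda\in\mathbf R_+$, $(X_i^j,Y_i^j)\in\mathbf S^{K+2}\times\mathbf R^{K+1}$ and $y_i^j\in\mathbf R_+^{M}$. The feasible set of this problem is convex. Moreover $\|\cdot\|_{D^{-1}}$ is the dual norm of $\|\cdot\|_D$: $$\sup\{\langle U,Z\rangle : Z\in\mathbf S^{K+2}\times\mathbf R^{K+1},\ \|Z\|_D\le 1\}=\|U\|_{D^{-1}}\qquad\text{for all } U\in\mathbf S^{K+2}\times\mathbf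 R^{K+1}.$$ -/

import Mathlib

open scoped Matrix ENNReal

noncomputable section

namespace DroPep

/-- The index set `I = {⋆, 0, 1, …, K}`; `none` is the optimality index `⋆`. -/
abbrev Idx (K : ℕ) : Type := Option (Fin (K + 1))

/-- The index set `M = {(i, j) ∈ I × I | i ≠ j}` of the interpolation inequalities. -/
abbrev PairIdx (K : ℕ) : Type := {p : Idx K × Idx K // p.1 ≠ p.2}

/-- Pairs of a `(K+2) × (K+2)` matrix and a vector in `ℝ^(K+1)`. The space `S^(K+2) × ℝ^(K+1)`
consists of the pairs whose first component is symmetric. -/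
abbrev GramPair (K : ℕ) : Type :=
  Matrix (Fin (K + 2)) (Fin (K + 2)) ℝ × (Fin (K + 1) → ℝ)

/-- `⟨(X, Y), (G, F)⟩ = tr(Xᵀ G) + Yᵀ F`. -/
def pairing {K : ℕ} (U Z : GramPair K) : ℝ :=
  (U.1ᵀ * Z.1).trace + U.2 ⬝ᵥ Z.2

/-- The data of the interpolation inequalities `⟨(A_m, b_m), Z⟩ ≤ 0` and of the initial condition
`⟨(A_0, b_0), Z⟩ + c_0 ≤ 0`. -/
structure PEPData (K : ℕ) where
  /-- the pairs `(A_m, b_m)` -/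
  Ab : PairIdx K → GramPair K
  Ab_symm : ∀ m, (Ab m).1.IsSymm
  /-- the pair `(A_0, b_0)` -/
  Ab0 : GramPair K
  Ab0_symm : Ab0.1.IsSymm
  /-- the constant `c_0` -/
  c0 : ℝ

/-- The data of the pieces `ℓ^j(Z) = ⟨(A_obj^j, b_obj^j), Z⟩ + c_obj^j t` of the loss. -/
structure LossData (K J : ℕ) where
  /-- the pairs `(A_obj^j, b_obj^j)` -/
  Ab : Fin J → GramPair K
  Ab_symm : ∀ j, (Ab j).1.IsSymm
  /-- the constants `c_obj^j` -/
  c : Fin J → ℝ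

section Support

variable {K : ℕ}

/-- `𝒮(G, F) = (-⟨(A_m, b_m), (G, F)⟩)_m`. -/
def PEPData.opS (P : PEPData K) (Z : GramPair K) : PairIdx K → ℝ :=
  fun m => -pairing (P.Ab m) Z

/-- The adjoint `𝒮*(y) = -∑ m, y_m (A_m, b_m)`. -/
def PEPData.opSadj (P : PEPData K) (y : PairIdx K → ℝ) : GramPair K :=
  -∑ m, y m • P.Ab m

/-- The function class in lifted form: `G ⪰ 0` and `𝒮(G, F) ≥ 0`. -/
def PEPData.classSet (P : PEPData K) : Set (GramPair K) :=
  {Z | Z.1.PosSemidef ∧ ∀ m, 0 ≤ P.opS Z m}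

/-- The initial condition in lifted form: `G ⪰ 0` and `⟨(A_0, b_0), (G, F)⟩ + c_0 ≤ 0`. -/
def PEPData.initSet (P : PEPData K) : Set (GramPair K) :=
  {Z | Z.1.PosSemidef ∧ pairing P.Ab0 Z + P.c0 ≤ 0}

/-- The common support set `ℱ ∩ 𝒳` of the distributions. -/
def PEPData.supportSet (P : PEPData K) : Set (GramPair K) :=
  P.classSet ∩ P.initSet

end Support

section Norm

/-- The square root of a diagonal matrix with nonnegative entries. -/
def diagSqrt {n : ℕ} (D : Matrix (Fin n) (Fin n) ℝ) : Matrix (Fin n) (Fin n) ℝ :=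
  Matrix.diagonal fun i => Real.sqrt (D i i)

/-- `‖(G, F)‖ = √(‖G‖_F² + ‖F‖²)`, with the Frobenius and the Euclidean norm. -/
def pairNorm {K : ℕ} (Z : GramPair K) : ℝ :=
  Real.sqrt (∑ i, ∑ j, Z.1 i j ^ 2 + ∑ k, Z.2 k ^ 2)

/-- `‖(G, F)‖_D = ‖(D_G^{1/2} G D_G^{1/2}, D_F F)‖` for `D = (D_G, D_F)`. -/
def scaledNorm {K : ℕ} (DG : Matrix (Fin (K + 2)) (Fin (K + 2)) ℝ)
    (DF : Matrix (Fin (K + 1)) (Fin (K + 1)) ℝ) (Z : GramPair K) : ℝ :=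
  pairNorm (diagSqrt DG * Z.1 * diagSqrt DG, DF *ᵥ Z.2)

end Norm

section Measures

open MeasureTheory

variable {K : ℕ}

/-- The Borel σ-algebra on matrices, i.e. the product σ-algebra on their entries. -/
instance instMeasurableSpaceMat (n : ℕ) : MeasurableSpace (Matrix (Fin n) (Fin n) ℝ) :=
  inferInstanceAs (MeasurableSpace (Fin n → Fin n → ℝ))

instance instBorelSpaceMat (n : ℕ) : BorelSpace (Matrix (Fin n) (Fin n) ℝ) :=
  inferInstanceAs (BorelSpace (Fin n → Fin n → ℝ))

/-- The couplings of `μ` and `ν`: joint distributions with marginals `μ` and `ν`. -/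
def couplings (μ ν : Measure (GramPair K)) : Set (Measure (GramPair K × GramPair K)) :=
  {π | π.map Prod.fst = μ ∧ π.map Prod.snd = ν}

/-- The type-1 Wasserstein distance with respect to the norm `nrm`. -/
def wasserstein (nrm : GramPair K → ℝ) (μ ν : Measure (GramPair K)) : ℝ≥0∞ :=
  ⨅ π ∈ couplings μ ν, ∫⁻ p, ENNReal.ofReal (nrm (p.1 - p.2)) ∂π

/-- The empirical distribution `(1/N) ∑ i, δ_{Ẑ_i}`. -/
def empirical {N : ℕ} (Zhat : Fin N → GramPair K) : Measure (GramPair K) :=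
  (N : ℝ≥0∞)⁻¹ • ∑ i, Measure.dirac (Zhat i)

/-- The ambiguity set: probability distributions supported on `ℱ ∩ 𝒳` within Wasserstein distance
`ε` of the empirical distribution. -/
def ambiguitySet (P : PEPData K) (nrm : GramPair K → ℝ) {N : ℕ} (Zhat : Fin N → GramPair K)
    (ε : ℝ) : Set (Measure (GramPair K)) :=
  {Q | IsProbabilityMeasure Q ∧ (∀ᵐ Z ∂Q, Z ∈ P.supportSet) ∧
    wasserstein nrm (empirical Zhat) Q ≤ ENNReal.ofReal ε}

/-- The family of losses `ℓ(Z) = max_j (⟨(A_obj^j, b_obj^j), Z⟩ + c_obj^j t)`, `t ∈ ℝ`. -/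
def lossFamily {J : ℕ} (L : LossData K J) : Set (GramPair K → ℝ) :=
  {ℓ | ∃ t : ℝ, ∀ Z, ℓ Z = ⨆ j, (pairing (L.Ab j) Z + L.c j * t)}

/-- The worst-case expectation `sup_Q inf_ℓ E_Q[ℓ]`, as an extended real number. -/
def worstCaseExpectation (P : PEPData K) (nrm : GramPair K → ℝ) {J N : ℕ} (L : LossData K J)
    (Zhat : Fin N → GramPair K) (ε : ℝ) : EReal :=
  ⨆ Q ∈ ambiguitySet P nrm Zhat ε, ⨅ ℓ ∈ lossFamily L, ((∫ Z, ℓ Z ∂Q : ℝ) : EReal)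

end Measures

section Program

variable {K J N : ℕ}

/-- The variables `(s, t, τ, (X, Y), λ, y)` of the minimization problem. -/
abbrev Vars (K J N : ℕ) : Type :=
  (Fin N → ℝ) × ℝ × (Fin N → Fin J → ℝ) × (Fin N → Fin J → GramPair K) × ℝ ×
    (Fin N → Fin J → PairIdx K → ℝ)

/-- The constraints of the minimization problem. The function `nrm` is the norm in the constraint
`‖(X_i^j, Y_i^j)‖ ≤ λ`. -/
structure IsFeasible (P : PEPData K) (nrm : GramPair K → ℝ) (L : LossData K J)
    (Zhat : Fin N → GramPair K) (ε : ℝ) (s : Fin N → ℝ) (t : ℝ) (τ : Fin N → Fin J → ℝ)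
    (XY : Fin N → Fin J → GramPair K) (lam : ℝ) (y : Fin N → Fin J → PairIdx K → ℝ) : Prop where
  tau_nonneg : ∀ i j, 0 ≤ τ i j
  XY_symm : ∀ i j, (XY i j).1.IsSymm
  lam_nonneg : 0 ≤ lam
  y_nonneg : ∀ i j m, 0 ≤ y i j m
  epigraph : ∀ i j,
    L.c j * t - P.c0 * τ i j - pairing (XY i j) (Zhat i) + lam * ε ≤ s i
  psd : ∀ i j,
    (-P.opSadj (y i j) - XY i j + τ i j • P.Ab0 - L.Ab j).1.PosSemidef
  eq_zero : ∀ i j,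
    (-P.opSadj (y i j) - XY i j + τ i j • P.Ab0 - L.Ab j).2 = 0
  norm_le : ∀ i j, nrm (XY i j) ≤ lam

/-- The feasible set of the minimization problem. -/
def feasibleSet (P : PEPData K) (nrm : GramPair K → ℝ) (L : LossData K J)
    (Zhat : Fin N → GramPair K) (ε : ℝ) : Set (Vars K J N) :=
  {v | IsFeasible P nrm L Zhat ε v.1 v.2.1 v.2.2.1 v.2.2.2.1 v.2.2.2.2.1 v.2.2.2.2.2}

/-- The objective `(1/N) ∑ i, s_i`. -/
def objective (v : Vars K J N) : ℝ := (1 / (N : ℝ)) * ∑ i, v.1 i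

/-- The optimal value of the minimization problem, as an extended real number. -/
def droPepValue (P : PEPData K) (nrm : GramPair K → ℝ) (L : LossData K J)
    (Zhat : Fin N → GramPair K) (ε : ℝ) : EReal :=
  ⨅ v ∈ feasibleSet P nrm L Zhat ε, (objective v : EReal)

end Program

end DroPep

end

/-!
The maximization over distributions reduces to a convex problem in three dimensions. A distribution
in the Wasserstein ball is an average of distributions `Q_i`, one for each sample `Ẑ_i`, whose mean
distances to the samples average to at most `ε`. To a piece `j` of the loss and a point `Z` of the
support set belongs the triple `(c_obj^j, ‖Ẑ_i - Z‖_D, ⟨(A_obj^j, b_obj^j), Z⟩)`; these triples form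
a compact set (`pieceSet`), and a point `(a, d, v)` of its convex hull yields a `Q_i` with mean
distance at most `d` and with expected loss at least `v + a t` for every `t`
(`convex_attainable`). So an average of such points with `a = 0`, `d ≤ ε` and `v ≥ r` gives a
distribution in the ball whose expected loss is at least `r` for all `t`
(`exists_mem_ambiguitySet`).

If there is no such average, the compact convex set of averages is separated from
`{0} × (-∞, ε] × [r, ∞)`. The separating functional consists of the parameter `t` of the loss and of
the price `λ` of transport (`exists_lagrange_multipliers`); the convex hulls are compact by
Carathéodory's theorem. What remains for each `i` and `j` is the bound
`⟨(A_obj^j, b_obj^j), Z⟩ - λ ‖Z - Ẑ_i‖_D < σ` on the support set, which conic duality turns into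
multipliers `(X, Y)`, `y`, `τ` (`exists_multipliers`). Without a constraint qualification the cone
generated by the constraints need not be closed. But the norm bound may be relaxed from `λ` to
`λ + δ` at a cost proportional to `δ`, and after this relaxation the set to be separated from the
origin is open. The separating functional is a point of the cone over the support set; it is not a
recession direction, because the support set is compact and contains the samples.

The reverse inequality is weak duality, integrated against a nearly optimal coupling
(`pairing_le_of_multipliers`, `integral_loss_le_of_coupling`). The duality of `‖·‖_D` and
`‖·‖_{D⁻¹}` is the Cauchy–Schwarz inequality after a diagonal rescaling (`inner_scaledEmbedding`).
-/

namespace DroPep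

/-! ### The pairing and the scaled norms -/

section Pairing

variable {K : ℕ}

theorem pairing_eq_sum (U Z : GramPair K) :
    pairing U Z = ∑ i, ∑ j, U.1 i j * Z.1 i j + ∑ k, U.2 k * Z.2 k := by
  unfold pairing
  congr 1
  simp only [Matrix.trace, Matrix.diag_apply, Matrix.mul_apply, Matrix.transpose_apply]
  exact Finset.sum_comm

theorem pairing_comm (U Z : GramPair K) : pairing U Z = pairing Z U := by
  simp only [pairing_eq_sum, mul_comm]

theorem pairing_add_right (U Z W : GramPair K) :
    pairing U (Z + W) = pairing U Z + pairing U W := by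
  simp [pairing, Matrix.mul_add, Matrix.trace_add, dotProduct_add]
  ring

theorem pairing_smul_right (a : ℝ) (U Z : GramPair K) :
    pairing U (a • Z) = a * pairing U Z := by
  simp [pairing, Matrix.trace_smul, dotProduct_smul]
  ring

/-- The pairing as a bilinear form. -/
noncomputable def pairingForm (K : ℕ) : GramPair K →ₗ[ℝ] GramPair K →ₗ[ℝ] ℝ :=
  LinearMap.mk₂ ℝ pairing
    (fun U V Z => by
      rw [pairing_comm, pairing_add_right, pairing_comm Z U, pairing_comm Z V])
    (fun a U Z => by rw [pairing_comm, pairing_smul_right, pairing_comm Z U, smul_eq_mul])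
    pairing_add_right pairing_smul_right

theorem pairingForm_apply (U Z : GramPair K) : pairingForm K U Z = pairing U Z := rfl

theorem pairing_add_left (U V Z : GramPair K) :
    pairing (U + V) Z = pairing U Z + pairing V Z :=
  (pairingForm K).map_add₂ U V Z

theorem pairing_smul_left (a : ℝ) (U Z : GramPair K) :
    pairing (a • U) Z = a * pairing U Z :=
  (pairingForm K).map_smul₂ a U Z

theorem pairing_sub_left (U V Z : GramPair K) :
    pairing (U - V) Z = pairing U Z - pairing V Z :=
  (pairingForm K).map_sub₂ U V Z

theorem pairing_sub_right (U Z W : GramPair K) :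
    pairing U (Z - W) = pairing U Z - pairing U W :=
  map_sub (pairingForm K U) Z W

theorem pairing_neg_left (U Z : GramPair K) : pairing (-U) Z = -pairing U Z :=
  (pairingForm K).map_neg₂ U Z

theorem pairing_sum_left {ι : Type*} (s : Finset ι) (U : ι → GramPair K) (Z : GramPair K) :
    pairing (∑ i ∈ s, U i) Z = ∑ i ∈ s, pairing (U i) Z := by
  simp only [← pairingForm_apply, map_sum, LinearMap.sum_apply]

theorem pairing_zero_left (Z : GramPair K) : pairing 0 Z = 0 :=
  (pairingForm K).map_zero₂ Z

theorem continuous_pairing (U : GramPair K) : Continuous fun Z => pairing U Z := by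
  simp only [pairing_eq_sum]
  fun_prop

theorem eq_zero_of_pairing_self_nonpos {Z : GramPair K} (h : pairing Z Z ≤ 0) : Z = 0 := by
  rw [pairing_eq_sum] at h
  have h1 : 0 ≤ ∑ i, ∑ j, Z.1 i j * Z.1 i j :=
    Finset.sum_nonneg fun i _ => Finset.sum_nonneg fun j _ => mul_self_nonneg _
  have h2 : 0 ≤ ∑ k, Z.2 k * Z.2 k := Finset.sum_nonneg fun k _ => mul_self_nonneg _
  have h1' : ∑ i, ∑ j, Z.1 i j * Z.1 i j = 0 := by linarith
  have h2' : ∑ k, Z.2 k * Z.2 k = 0 := by linarith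
  refine Prod.ext ?_ ?_
  · ext i j
    have := (Finset.sum_eq_zero_iff_of_nonneg
      fun i _ => Finset.sum_nonneg fun j _ => mul_self_nonneg (Z.1 i j)).1 h1' i (Finset.mem_univ _)
    have := (Finset.sum_eq_zero_iff_of_nonneg
      fun j _ => mul_self_nonneg (Z.1 i j)).1 this j (Finset.mem_univ _)
    simpa using this
  · ext k
    have := (Finset.sum_eq_zero_iff_of_nonneg
      fun k _ => mul_self_nonneg (Z.2 k)).1 h2' k (Finset.mem_univ _)
    simpa using this

open scoped MatrixOrder Matrix.Norms.L2Operator in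
/-- The cone of positive semidefinite matrices is self-dual (one inclusion). -/
theorem trace_transpose_mul_nonneg {n : ℕ} {A B : Matrix (Fin n) (Fin n) ℝ}
    (hA : A.PosSemidef) (hB : B.PosSemidef) : 0 ≤ (Aᵀ * B).trace := by
  obtain ⟨C, rfl⟩ := CStarAlgebra.nonneg_iff_eq_star_mul_self.1 hB.nonneg
  rw [Matrix.star_eq_conjTranspose]
  rw [← Matrix.mul_assoc, Matrix.trace_mul_comm, ← Matrix.mul_assoc]
  exact (hA.transpose.mul_mul_conjTranspose_same C).trace_nonneg

theorem pairing_nonneg {U Z : GramPair K} (hU : U.1.PosSemidef) (hU2 : U.2 = 0)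
    (hZ : Z.1.PosSemidef) : 0 ≤ pairing U Z := by
  simpa [pairing, hU2] using trace_transpose_mul_nonneg hU hZ

/-- Every continuous linear functional on `GramPair K × ℝ` is given by the pairing with some
element. -/
theorem exists_pairing_repr (f : StrongDual ℝ (GramPair K × ℝ)) :
    ∃ (Z : GramPair K) (s : ℝ), ∀ U ρ, f (U, ρ) = pairing U Z + s * ρ := by
  refine ⟨(Matrix.of fun i j => f ((Matrix.single i j 1, 0), 0),
    fun k => f ((0, Pi.single k 1), 0)), f (0, 1), fun U ρ => ?_⟩
  have hU : ((U, ρ) : GramPair K × ℝ) =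
      ∑ i, ∑ j, U.1 i j • (((Matrix.single i j 1, 0), 0) : GramPair K × ℝ)
        + ∑ k, U.2 k • (((0, Pi.single k 1), 0) : GramPair K × ℝ)
        + ρ • ((0, 1) : GramPair K × ℝ) := by
    refine Prod.ext (Prod.ext ?_ ?_) ?_
    · simp only [Prod.fst_add, Prod.fst_sum, Prod.smul_fst]
      conv_lhs => rw [Matrix.matrix_eq_sum_single U.1]
      simp [Matrix.smul_single]
    · simp only [Prod.fst_add, Prod.snd_add, Prod.fst_sum, Prod.smul_fst, Prod.snd_sum,
        Prod.smul_snd]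
      ext k
      simp [Finset.sum_apply, Pi.single_apply]
    · simp [Prod.snd_sum]
  rw [hU]
  simp only [map_add, map_sum, map_smul, smul_eq_mul, pairing_eq_sum, Matrix.of_apply]
  ring

end Pairing

section ScaledNorm

variable {K : ℕ} (DG : Matrix (Fin (K + 2)) (Fin (K + 2)) ℝ)
    (DF : Matrix (Fin (K + 1)) (Fin (K + 1)) ℝ)

/-- The linear map `(G, F) ↦ (D_G^{1/2} G D_G^{1/2}, D_F F)` into a Euclidean space; the scaled
norm is the pullback of the Euclidean norm along it. -/
noncomputable def scaledEmbedding : GramPair K →ₗ[ℝ]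
    EuclideanSpace ℝ ((Fin (K + 2) × Fin (K + 2)) ⊕ Fin (K + 1)) where
  toFun Z := WithLp.toLp 2 (Sum.elim (fun p => (diagSqrt DG * Z.1 * diagSqrt DG) p.1 p.2)
    (DF *ᵥ Z.2))
  map_add' Z W := by
    ext (p | k) <;> simp [Matrix.mul_add, Matrix.add_mul, Matrix.mulVec_add]
  map_smul' a Z := by
    ext (p | k) <;> simp [Matrix.mulVec_smul]

theorem scaledNorm_eq_norm (Z : GramPair K) :
    scaledNorm DG DF Z = ‖scaledEmbedding DG DF Z‖ := by
  rw [EuclideanSpace.norm_eq, scaledNorm, pairNorm]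
  simp [scaledEmbedding, Fintype.sum_prod_type]

theorem scaledNorm_nonneg (Z : GramPair K) : 0 ≤ scaledNorm DG DF Z := Real.sqrt_nonneg _

theorem scaledNorm_add_le (Z W : GramPair K) :
    scaledNorm DG DF (Z + W) ≤ scaledNorm DG DF Z + scaledNorm DG DF W := by
  simpa only [scaledNorm_eq_norm, map_add] using norm_add_le _ _

theorem scaledNorm_smul (a : ℝ) (Z : GramPair K) :
    scaledNorm DG DF (a • Z) = |a| * scaledNorm DG DF Z := by
  simp only [scaledNorm_eq_norm, map_smul, norm_smul, Real.norm_eq_abs]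

theorem scaledNorm_neg (Z : GramPair K) : scaledNorm DG DF (-Z) = scaledNorm DG DF Z := by
  simp only [scaledNorm_eq_norm, map_neg, norm_neg]

theorem scaledNorm_zero : scaledNorm DG DF 0 = 0 := by
  simp only [scaledNorm_eq_norm, map_zero, norm_zero]

theorem continuous_scaledNorm : Continuous (scaledNorm DG DF) := by
  unfold scaledNorm pairNorm
  fun_prop

theorem convex_scaledNorm_lt (a : ℝ) : Convex ℝ {Z | scaledNorm DG DF Z < a} := by
  have : {Z | scaledNorm DG DF Z < a} =
      scaledEmbedding DG DF ⁻¹' Metric.ball 0 a := by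
    ext Z; simp [scaledNorm_eq_norm]
  rw [this]
  exact (convex_ball _ _).linear_preimage _

theorem convex_scaledNorm_epigraph :
    Convex ℝ {p : GramPair K × ℝ | scaledNorm DG DF p.1 ≤ p.2} := by
  rintro ⟨Z, a⟩ hZ ⟨W, b⟩ hW u v hu hv -
  simp only [Set.mem_ofPred_eq, Prod.smul_mk, Prod.mk_add_mk, smul_eq_mul] at *
  calc _ ≤ scaledNorm DG DF (u • Z) + scaledNorm DG DF (v • W) := scaledNorm_add_le _ _ _ _
    _ ≤ _ := by
      rw [scaledNorm_smul, scaledNorm_smul, abs_of_nonneg hu, abs_of_nonneg hv]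
      gcongr

theorem diagSqrt_mul_mul_apply (Z : Matrix (Fin (K + 2)) (Fin (K + 2)) ℝ) (i j) :
    (diagSqrt DG * Z * diagSqrt DG) i j = √(DG i i) * Z i j * √(DG j j) := by
  simp [diagSqrt]

/-- The scaled norm does not see the difference between a matrix and its transpose. -/
theorem scaledNorm_transpose (Z : GramPair K) :
    scaledNorm DG DF (Z.1ᵀ, Z.2) = scaledNorm DG DF Z := by
  unfold scaledNorm pairNorm
  simp only [diagSqrt_mul_mul_apply, Matrix.transpose_apply]
  rw [Finset.sum_comm]
  congr 2
  exact Finset.sum_congr rfl fun i _ => Finset.sum_congr rfl fun j _ => by ring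

variable {DG DF}

theorem inv_eq_diagonal_of_isDiag {n : ℕ} {D : Matrix (Fin n) (Fin n) ℝ} (hD : D.PosDef)
    (hdiag : D.IsDiag) : D⁻¹ = Matrix.diagonal fun i => (D i i)⁻¹ := by
  refine Matrix.inv_eq_left_inv ?_
  have h : Matrix.diagonal (fun i => (D i i)⁻¹) * D =
      Matrix.diagonal (fun i => (D i i)⁻¹) * Matrix.diagonal D.diag := by
    rw [hdiag.diagonal_diag]
  rw [h, Matrix.diagonal_mul_diagonal, ← Matrix.diagonal_one]
  congr 1
  ext i
  exact inv_mul_cancel₀ hD.diag_pos.ne'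

theorem mulVec_of_isDiag {n : ℕ} {D : Matrix (Fin n) (Fin n) ℝ} (hdiag : D.IsDiag)
    (v : Fin n → ℝ) : D *ᵥ v = fun k => D k k * v k := by
  conv_lhs => rw [← hdiag.diagonal_diag]
  ext k
  simp [Matrix.mulVec_diagonal]

/-- The scalings by `D⁻¹` and by `D` cancel in the pairing. -/
theorem inner_scaledEmbedding (hDG : DG.PosDef) (hDGdiag : DG.IsDiag) (hDF : DF.PosDef)
    (hDFdiag : DF.IsDiag) (U Z : GramPair K) :
    inner ℝ (scaledEmbedding DG⁻¹ DF⁻¹ U) (scaledEmbedding DG DF Z) = pairing U Z := by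
  rw [inv_eq_diagonal_of_isDiag hDG hDGdiag, inv_eq_diagonal_of_isDiag hDF hDFdiag]
  simp only [PiLp.inner_apply, scaledEmbedding, LinearMap.coe_mk, AddHom.coe_mk,
    Fintype.sum_sum_type, Fintype.sum_prod_type, Sum.elim_inl, Sum.elim_inr,
    diagSqrt_mul_mul_apply, Matrix.diagonal_apply_eq, Matrix.mulVec_diagonal,
    mulVec_of_isDiag hDFdiag,
    RCLike.inner_apply, conj_trivial, pairing_eq_sum, Real.sqrt_inv]
  congr 1
  · refine Finset.sum_congr rfl fun i _ => Finset.sum_congr rfl fun j _ => ?_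
    have hi := (Real.sqrt_pos.2 (hDG.diag_pos (i := i))).ne'
    have hj := (Real.sqrt_pos.2 (hDG.diag_pos (i := j))).ne'
    field_simp
  · refine Finset.sum_congr rfl fun k _ => ?_
    have hk := (hDF.diag_pos (i := k)).ne'
    field_simp

theorem pairing_le_scaledNorm_mul (hDG : DG.PosDef) (hDGdiag : DG.IsDiag) (hDF : DF.PosDef)
    (hDFdiag : DF.IsDiag) (U Z : GramPair K) :
    pairing U Z ≤ scaledNorm DG⁻¹ DF⁻¹ U * scaledNorm DG DF Z := by
  rw [← inner_scaledEmbedding hDG hDGdiag hDF hDFdiag, scaledNorm_eq_norm, scaledNorm_eq_norm]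
  exact real_inner_le_norm _ _

/-- The rescaling `(D_G⁻¹ G D_G⁻¹, D_F⁻² F)` of `U = (G, F)` is the direction for which the
Cauchy–Schwarz inequality in `pairing_le_scaledNorm_mul` is an equality. -/
theorem exists_scaledEmbedding_eq (hDG : DG.PosDef) (hDGdiag : DG.IsDiag) (hDF : DF.PosDef)
    (hDFdiag : DF.IsDiag) (U : GramPair K) :
    ∃ Z : GramPair K, (U.1.IsSymm → Z.1.IsSymm) ∧
      scaledEmbedding DG DF Z = scaledEmbedding DG⁻¹ DF⁻¹ U := by
  refine ⟨(Matrix.of fun i j => (DG i i)⁻¹ * U.1 i j * (DG j j)⁻¹,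
    fun k => (DF k k)⁻¹ * ((DF k k)⁻¹ * U.2 k)), fun hU => ?_, ?_⟩
  · ext i j
    simp only [Matrix.transpose_apply, Matrix.of_apply]
    rw [hU.apply i j]; ring
  · rw [inv_eq_diagonal_of_isDiag hDG hDGdiag, inv_eq_diagonal_of_isDiag hDF hDFdiag]
    ext (p | k)
    · simp only [scaledEmbedding, LinearMap.coe_mk, AddHom.coe_mk, Sum.elim_inl,
        diagSqrt_mul_mul_apply, Matrix.diagonal_apply_eq, Matrix.of_apply, Real.sqrt_inv]
      have hi := Real.sqrt_pos.2 (hDG.diag_pos (i := p.1))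
      have hj := Real.sqrt_pos.2 (hDG.diag_pos (i := p.2))
      have hi' := Real.mul_self_sqrt (hDG.diag_pos (i := p.1)).le
      have hj' := Real.mul_self_sqrt (hDG.diag_pos (i := p.2)).le
      conv_lhs =>
        rw [show (DG p.1 p.1)⁻¹ = (√(DG p.1 p.1) * √(DG p.1 p.1))⁻¹ by rw [hi'],
          show (DG p.2 p.2)⁻¹ = (√(DG p.2 p.2) * √(DG p.2 p.2))⁻¹ by rw [hj']]
      field_simp
    · have hk := (hDF.diag_pos (i := k)).ne'
      simp only [scaledEmbedding, LinearMap.coe_mk, AddHom.coe_mk, Sum.elim_inr,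
        Matrix.mulVec_diagonal, mulVec_of_isDiag hDFdiag]
      field_simp

theorem exists_scaledNorm_le_one_pairing_eq (hDG : DG.PosDef) (hDGdiag : DG.IsDiag)
    (hDF : DF.PosDef) (hDFdiag : DF.IsDiag) (U : GramPair K) :
    ∃ Z : GramPair K, (U.1.IsSymm → Z.1.IsSymm) ∧ scaledNorm DG DF Z ≤ 1 ∧
      pairing U Z = scaledNorm DG⁻¹ DF⁻¹ U := by
  obtain ⟨Z, hsymm, hZ⟩ := exists_scaledEmbedding_eq hDG hDGdiag hDF hDFdiag U
  -- if `‖U‖_{D⁻¹} = 0`, the scalar below is the junk value `0⁻¹ = 0`, and the zero vector works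
  refine ⟨(scaledNorm DG⁻¹ DF⁻¹ U)⁻¹ • Z, fun hU => (hsymm hU).smul _, ?_, ?_⟩
  · rw [scaledNorm_smul, scaledNorm_eq_norm DG DF, hZ, ← scaledNorm_eq_norm,
      abs_of_nonneg (inv_nonneg.2 (scaledNorm_nonneg _ _ _))]
    exact inv_mul_le_one
  · rw [pairing_smul_right, ← inner_scaledEmbedding hDG hDGdiag hDF hDFdiag, hZ,
      real_inner_self_eq_norm_sq, ← scaledNorm_eq_norm]
    rcases eq_or_ne (scaledNorm DG⁻¹ DF⁻¹ U) 0 with h | h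
    · simp [h]
    · field_simp

theorem isLUB_pairing (hDG : DG.PosDef) (hDGdiag : DG.IsDiag) (hDF : DF.PosDef)
    (hDFdiag : DF.IsDiag) {U : GramPair K} (hU : U.1.IsSymm) :
    IsLUB {r : ℝ | ∃ Z : GramPair K, Z.1.IsSymm ∧ scaledNorm DG DF Z ≤ 1 ∧ r = pairing U Z}
      (scaledNorm DG⁻¹ DF⁻¹ U) := by
  refine IsGreatest.isLUB ⟨?_, ?_⟩
  · obtain ⟨Z, hs, h1, h2⟩ := exists_scaledNorm_le_one_pairing_eq hDG hDGdiag hDF hDFdiag U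
    exact ⟨Z, hs hU, h1, h2.symm⟩
  · rintro _ ⟨Z, -, h1, rfl⟩
    exact (pairing_le_scaledNorm_mul hDG hDGdiag hDF hDFdiag U Z).trans
      (mul_le_of_le_one_right (scaledNorm_nonneg _ _ _) h1)

/-- The converse form of duality: `U ↦ ⟨U, Z⟩` attains `‖Z‖_D` on the unit ball of
`‖·‖_{D⁻¹}`. -/
theorem exists_dual_unit (hDG : DG.PosDef) (hDGdiag : DG.IsDiag)
    (hDF : DF.PosDef) (hDFdiag : DF.IsDiag) (Z : GramPair K) :
    ∃ U : GramPair K, scaledNorm DG⁻¹ DF⁻¹ U ≤ 1 ∧ pairing U Z = scaledNorm DG DF Z := by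
  have hdiag : ∀ {n : ℕ} {D : Matrix (Fin n) (Fin n) ℝ}, D.PosDef → D.IsDiag → D⁻¹.IsDiag :=
    fun h hd => by rw [inv_eq_diagonal_of_isDiag h hd]; exact Matrix.isDiag_diagonal _
  obtain ⟨U, -, h1, h2⟩ := exists_scaledNorm_le_one_pairing_eq hDG.inv (hdiag hDG hDGdiag)
    hDF.inv (hdiag hDF hDFdiag) Z
  have e : ∀ {n : ℕ} {D : Matrix (Fin n) (Fin n) ℝ}, D.PosDef → D⁻¹⁻¹ = D := fun h =>
    Matrix.nonsing_inv_nonsing_inv _ ((Matrix.isUnit_iff_isUnit_det _).1 h.isUnit)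
  rw [e hDG, e hDF] at h2
  exact ⟨U, h1, by rw [pairing_comm, h2]⟩

end ScaledNorm

/-! ### Conic duality for the support set -/

section Conic

variable {K : ℕ}

theorem PEPData.opSadj_add (P : PEPData K) (y z : PairIdx K → ℝ) :
    P.opSadj (y + z) = P.opSadj y + P.opSadj z := by
  simp only [PEPData.opSadj, Pi.add_apply, add_smul, Finset.sum_add_distrib, neg_add]

theorem PEPData.opSadj_smul (P : PEPData K) (a : ℝ) (y : PairIdx K → ℝ) :
    P.opSadj (a • y) = a • P.opSadj y := by
  simp only [PEPData.opSadj, Pi.smul_apply, smul_neg, Finset.smul_sum, smul_smul, smul_eq_mul]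

theorem PEPData.pairing_opSadj (P : PEPData K) (y : PairIdx K → ℝ) (Z : GramPair K) :
    pairing (P.opSadj y) Z = ∑ m, y m * P.opS Z m := by
  simp only [PEPData.opSadj, PEPData.opS, pairing_neg_left, pairing_sum_left, pairing_smul_left,
    mul_neg, Finset.sum_neg_distrib]

theorem PEPData.opSadj_isSymm (P : PEPData K) (y : PairIdx K → ℝ) : (P.opSadj y).1.IsSymm := by
  simp only [PEPData.opSadj, Prod.fst_neg, Prod.fst_sum, Prod.smul_fst, Matrix.IsSymm,
    Matrix.transpose_neg, Matrix.transpose_sum, Matrix.transpose_smul, (P.Ab_symm _).eq]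

/-- Weak duality: the constraints on the multipliers bound the piece of the loss on the support
set, up to the transport cost. -/
theorem pairing_le_of_multipliers (P : PEPData K) {A Zh Z X : GramPair K} {y : PairIdx K → ℝ}
    {τ b : ℝ} (hZ : Z ∈ P.supportSet) (hτ : 0 ≤ τ) (hy : ∀ m, 0 ≤ y m)
    (hpsd : (-P.opSadj y - X + τ • P.Ab0 - A).1.PosSemidef)
    (hzero : (-P.opSadj y - X + τ • P.Ab0 - A).2 = 0) (hb : pairing X (Zh - Z) ≤ b) :
    pairing A Z ≤ -P.c0 * τ - pairing X Zh + b := by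
  have h := pairing_nonneg hpsd hzero hZ.1.1
  rw [pairing_sub_left, pairing_add_left, pairing_sub_left, pairing_neg_left, pairing_smul_left,
    P.pairing_opSadj] at h
  have h1 : 0 ≤ ∑ m, y m * P.opS Z m :=
    Finset.sum_nonneg fun m _ => mul_nonneg (hy m) (hZ.1.2 m)
  have h2 := mul_le_mul_of_nonneg_left hZ.2.2 hτ
  rw [pairing_sub_right] at hb
  linarith

theorem nonpos_of_forall_add_mul_neg {a b : ℝ} (h : ∀ n : ℝ, 0 ≤ n → a + n * b < 0) : b ≤ 0 := by
  by_contra! hb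
  have := h (|a| / b) (by positivity)
  rw [div_mul_cancel₀ _ hb.ne'] at this
  linarith [neg_abs_le a]

/-- The symmetric part of a pair. -/
noncomputable def symmPart (X : GramPair K) : GramPair K := (2⁻¹ : ℝ) • (X + (X.1ᵀ, X.2))

theorem symmPart_isSymm (X : GramPair K) : (symmPart X).1.IsSymm := by
  simp [symmPart, Matrix.IsSymm, Matrix.transpose_add, add_comm]

theorem symmPart_snd (X : GramPair K) : (symmPart X).2 = X.2 := by
  ext k
  simp [symmPart]
  ring

theorem symmPart_of_isSymm {X : GramPair K} (h : X.1.IsSymm) : symmPart X = X := by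
  have : (X.1ᵀ, X.2) = X := Prod.ext h.eq rfl
  rw [symmPart, this]
  module

theorem symmPart_sub (X Y : GramPair K) : symmPart (X - Y) = symmPart X - symmPart Y := by
  have : ((X - Y).1ᵀ, (X - Y).2) = (X.1ᵀ, X.2) - (Y.1ᵀ, Y.2) := by simp
  simp only [symmPart, this]
  module

theorem pairing_symmPart (X : GramPair K) {Z : GramPair K} (hZ : Z.1.IsSymm) :
    pairing (symmPart X) Z = pairing X Z := by
  have : pairing (X.1ᵀ, X.2) Z = pairing X Z := by
    simp only [pairing, Matrix.transpose_transpose]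
    rw [← Matrix.trace_transpose (X.1 * Z.1), Matrix.transpose_mul, hZ.eq, Matrix.trace_mul_comm]
  rw [symmPart, pairing_smul_left, pairing_add_left, this]
  ring

theorem scaledNorm_symmPart_le (DG : Matrix (Fin (K + 2)) (Fin (K + 2)) ℝ)
    (DF : Matrix (Fin (K + 1)) (Fin (K + 1)) ℝ) (X : GramPair K) :
    scaledNorm DG DF (symmPart X) ≤ scaledNorm DG DF X := by
  have := scaledNorm_add_le DG DF X (X.1ᵀ, X.2)
  rw [scaledNorm_transpose] at this
  rw [symmPart, scaledNorm_smul, abs_of_pos (by norm_num)]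
  linarith

theorem quadForm_symmPart (X : GramPair K) (x : Fin (K + 2) → ℝ) :
    x ⬝ᵥ (symmPart X).1 *ᵥ x = x ⬝ᵥ X.1 *ᵥ x := by
  have : x ⬝ᵥ X.1ᵀ *ᵥ x = x ⬝ᵥ X.1 *ᵥ x := by
    rw [Matrix.mulVec_transpose, dotProduct_comm, Matrix.dotProduct_mulVec]
  simp only [symmPart, Prod.smul_fst, Prod.fst_add, Matrix.smul_mulVec, Matrix.add_mulVec,
    dotProduct_smul, dotProduct_add, this, smul_eq_mul]
  ring

/-- The pairs `(k, 0)` where `k` has a nonnegative quadratic form. As `k` need not be symmetric,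
the dual cone of this cone consists of the pairs whose matrix is symmetric and positive
semidefinite. -/
def formCone (K : ℕ) : Set (GramPair K) :=
  {k | (∀ x, 0 ≤ x ⬝ᵥ k.1 *ᵥ x) ∧ k.2 = 0}

theorem smul_mem_formCone {k : GramPair K} (hk : k ∈ formCone K) {a : ℝ} (ha : 0 ≤ a) :
    a • k ∈ formCone K := by
  refine ⟨fun x => ?_, by simp [hk.2]⟩
  simpa [Matrix.smul_mulVec, dotProduct_smul] using mul_nonneg ha (hk.1 x)

theorem add_mem_formCone {k l : GramPair K} (hk : k ∈ formCone K) (hl : l ∈ formCone K) :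
    k + l ∈ formCone K := by
  refine ⟨fun x => ?_, by simp [hk.2, hl.2]⟩
  simpa [Matrix.add_mulVec, dotProduct_add] using add_nonneg (hk.1 x) (hl.1 x)

theorem zero_mem_formCone : (0 : GramPair K) ∈ formCone K := ⟨fun x => by simp, rfl⟩

theorem posSemidef_of_formCone {Z : GramPair K} (h : ∀ k ∈ formCone K, 0 ≤ pairing k Z) :
    Z.1.PosSemidef := by
  have hij : ∀ i j, Z.1 j i ≤ Z.1 i j := by
    intro i j
    have := h (Matrix.single i j 1 - Matrix.single j i 1, 0) ⟨fun x => by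
      simp only [Matrix.sub_mulVec, dotProduct_sub, Matrix.single_mulVec, one_mul, sub_nonneg]
      change x ⬝ᵥ Pi.single j (x i) ≤ x ⬝ᵥ Pi.single i (x j)
      simp [mul_comm], rfl⟩
    simpa [pairing, Matrix.sub_mul, Matrix.transpose_sub, Matrix.trace_sub,
      Matrix.transpose_single, Matrix.trace_single_mul] using this
  refine Matrix.posSemidef_iff_dotProduct_mulVec.2 ⟨?_, fun x => ?_⟩
  · ext i j
    simpa using le_antisymm (hij i j) (hij j i)
  · have := h (Matrix.vecMulVec x x, 0) ⟨fun z => by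
      rw [Matrix.vecMulVec_mulVec]
      simpa [dotProduct_smul, dotProduct_comm z x] using mul_self_nonneg (x ⬝ᵥ z), rfl⟩
    simpa [pairing, Matrix.transpose_vecMulVec, Matrix.vecMulVec_mul, Matrix.trace_vecMulVec,
      Matrix.dotProduct_mulVec, dotProduct_comm] using this

/-- A compact nonempty support set has no recession directions. -/
theorem PEPData.eq_zero_of_recession (P : PEPData K) (hC : IsCompact P.supportSet)
    {Zh Z : GramPair K} (hZh : Zh ∈ P.supportSet) (hZ : Z.1.PosSemidef)
    (hm : ∀ m, pairing (P.Ab m) Z ≤ 0) (h0 : pairing P.Ab0 Z ≤ 0) : Z = 0 := by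
  refine eq_zero_of_pairing_self_nonpos ?_
  obtain ⟨M, hM⟩ := hC.bddAbove_image (continuous_pairing Z).continuousOn
  refine nonpos_of_forall_add_mul_neg (a := pairing Z Zh - M - 1) fun n hn => ?_
  have hmem : Zh + n • Z ∈ P.supportSet := by
    have hpsd : (Zh + n • Z).1.PosSemidef := hZh.1.1.add (hZ.smul hn)
    refine ⟨⟨hpsd, fun m => ?_⟩, hpsd, ?_⟩
    · have h1 := hZh.1.2 m
      have h2 := mul_nonneg hn (neg_nonneg.2 (hm m))
      simp only [PEPData.opS] at h1 ⊢
      rw [pairing_add_right, pairing_smul_right]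
      linarith
    · have h1 := hZh.2.2
      have h2 := mul_nonneg hn (neg_nonneg.2 h0)
      rw [pairing_add_right, pairing_smul_right]
      linarith
  have := hM ⟨_, hmem, rfl⟩
  simp only [pairing_add_right, pairing_smul_right] at this
  linarith

variable {DG : Matrix (Fin (K + 2)) (Fin (K + 2)) ℝ} {DF : Matrix (Fin (K + 1)) (Fin (K + 1)) ℝ}

/-- Strong conic duality for one piece of the loss. No constraint qualification is assumed; in
exchange the bound on `‖X‖_{D⁻¹}` is relaxed from `lam` to `lam'`, which makes the set to be
separated from the origin open. -/
theorem exists_multipliers (hDG : DG.PosDef) (hDGdiag : DG.IsDiag)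
    (hDF : DF.PosDef) (hDFdiag : DF.IsDiag) (P : PEPData K) (hC : IsCompact P.supportSet)
    {Zh A : GramPair K} (hZh : Zh ∈ P.supportSet) (hA : A.1.IsSymm) {lam lam' σ : ℝ}
    (hlam : 0 ≤ lam) (hlam' : lam < lam')
    (hσ : ∀ Z ∈ P.supportSet, pairing A Z - lam * scaledNorm DG DF (Z - Zh) < σ) :
    ∃ (X : GramPair K) (y : PairIdx K → ℝ) (τ : ℝ), X.1.IsSymm ∧ 0 ≤ τ ∧ (∀ m, 0 ≤ y m) ∧
      (-P.opSadj y - X + τ • P.Ab0 - A).1.PosSemidef ∧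
      (-P.opSadj y - X + τ • P.Ab0 - A).2 = 0 ∧
      scaledNorm DG⁻¹ DF⁻¹ X ≤ lam' ∧ -P.c0 * τ - pairing X Zh ≤ σ := by
  set B : (PairIdx K → ℝ) → ℝ → GramPair K → GramPair K :=
    fun y τ k => -P.opSadj y + τ • P.Ab0 - k - A with hB
  -- `p ∈ E` perturbs the two linear constraints, by `p.1` and by `p.2`
  set E : Set (GramPair K × ℝ) := {p | ∃ y τ k, (∀ m, 0 ≤ y m) ∧ 0 ≤ τ ∧ k ∈ formCone K ∧
    scaledNorm DG⁻¹ DF⁻¹ (B y τ k - p.1) < lam' ∧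
      0 < p.2 + P.c0 * τ + pairing (B y τ k - p.1) Zh + σ} with hE
  have hopen : IsOpen E := by
    simp only [hE, Set.ofPred_exists, Set.ofPred_and]
    refine isOpen_iUnion fun y => isOpen_iUnion fun τ => isOpen_iUnion fun k => ?_
    refine isOpen_const.inter (isOpen_const.inter (isOpen_const.inter (IsOpen.inter ?_ ?_)))
    · exact isOpen_lt ((continuous_scaledNorm _ _).comp (by fun_prop)) continuous_const
    · refine isOpen_lt continuous_const ?_
      have : Continuous fun p : GramPair K × ℝ => pairing (B y τ k - p.1) Zh := by
        simp only [pairing_comm _ Zh]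
        exact (continuous_pairing Zh).comp (by fun_prop)
      fun_prop
  have hconv : Convex ℝ E := by
    rintro p ⟨y, τ, k, hy, hτ, hk, h1, h2⟩ q ⟨y', τ', k', hy', hτ', hk', h1', h2'⟩ a b ha hb hab
    have hX : B (a • y + b • y') (a * τ + b * τ') (a • k + b • k') - (a • p + b • q).1 =
        a • (B y τ k - p.1) + b • (B y' τ' k' - q.1) := by
      obtain rfl : b = 1 - a := by linarith
      simp only [hB, P.opSadj_add, P.opSadj_smul, Prod.fst_add, Prod.smul_fst]
      module
    refine ⟨a • y + b • y', a * τ + b * τ', a • k + b • k', fun m => ?_, by positivity,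
      add_mem_formCone (smul_mem_formCone hk ha) (smul_mem_formCone hk' hb), ?_, ?_⟩
    · exact add_nonneg (mul_nonneg ha (hy m)) (mul_nonneg hb (hy' m))
    · rw [hX]
      exact convex_scaledNorm_lt _ _ _ h1 h1' ha hb hab
    · rw [hX, pairing_add_left, pairing_smul_left, pairing_smul_left]
      simp only [Prod.snd_add, Prod.smul_snd, smul_eq_mul]
      have := convex_Ioi (0 : ℝ) (Set.mem_Ioi.2 h2) (Set.mem_Ioi.2 h2') ha hb hab
      simp only [smul_eq_mul, Set.mem_Ioi] at this
      have e : (a + b) * σ = σ := by rw [hab, one_mul]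
      linarith
  by_cases h0 : (0 : GramPair K × ℝ) ∈ E
  · obtain ⟨y, τ, k, hy, hτ, hk, h1, h2⟩ := h0
    simp only [Prod.fst_zero, Prod.snd_zero, sub_zero, zero_add] at h1 h2
    have hsym : (-P.opSadj y + τ • P.Ab0 - A).1.IsSymm := by
      refine ((P.opSadj_isSymm y).neg.add (P.Ab0_symm.smul τ)).sub hA
    have hk' : -P.opSadj y - symmPart (B y τ k) + τ • P.Ab0 - A = symmPart k := by
      have : B y τ k = (-P.opSadj y + τ • P.Ab0 - A) - k := by simp only [hB]; abel
      rw [this, symmPart_sub, symmPart_of_isSymm hsym]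
      abel
    refine ⟨symmPart (B y τ k), y, τ, symmPart_isSymm _, hτ, hy, ?_, ?_,
      (scaledNorm_symmPart_le _ _ _).trans h1.le, ?_⟩
    · rw [hk']
      refine Matrix.posSemidef_iff_dotProduct_mulVec.2 ⟨symmPart_isSymm k, fun x => ?_⟩
      rw [star_trivial, quadForm_symmPart]
      exact hk.1 x
    · rw [hk', symmPart_snd, hk.2]
    · rw [pairing_symmPart _ hZh.1.1.1]
      linarith
  exfalso
  obtain ⟨f, hf⟩ := geometric_hahn_banach_open_point hconv hopen h0
  obtain ⟨Z, s', hfZ⟩ := exists_pairing_repr f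
  obtain ⟨s, rfl⟩ : ∃ s, s' = -s := ⟨-s', by ring⟩
  have key : ∀ (y : PairIdx K → ℝ) τ k X r, (∀ m, 0 ≤ y m) → 0 ≤ τ → k ∈ formCone K →
      scaledNorm DG⁻¹ DF⁻¹ X < lam' → 0 < r →
      -(∑ m, y m * P.opS Z m) + τ * pairing P.Ab0 Z - pairing k Z - pairing A Z - pairing X Z
        + s * (P.c0 * τ + pairing X Zh - r + σ) < 0 := by
    intro y τ k X r hy hτ hk hX hr
    have := hf (B y τ k - X, -P.c0 * τ - pairing X Zh + r - σ)
      ⟨y, τ, k, hy, hτ, hk, by simpa using hX, by simp only [sub_sub_cancel]; linarith⟩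
    rw [map_zero, hfZ] at this
    simp only [hB, pairing_sub_left, pairing_add_left, pairing_neg_left, pairing_smul_left,
      P.pairing_opSadj] at this
    linarith
  have hX0 : scaledNorm DG⁻¹ DF⁻¹ (0 : GramPair K) < lam' := by
    rw [scaledNorm_zero]; exact hlam.trans_lt hlam'
  have hs : 0 ≤ s := by
    refine neg_nonpos.1 (nonpos_of_forall_add_mul_neg (a := -pairing A Z + s * (-1 + σ)) ?_)
    intro n hn
    have := key 0 0 0 0 (1 + n) (fun _ => le_rfl) le_rfl zero_mem_formCone hX0 (by linarith)
    simp only [Pi.zero_apply, zero_mul, Finset.sum_const_zero, pairing_zero_left] at this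
    linarith
  have hm : ∀ m, pairing (P.Ab m) Z ≤ 0 := fun m => by
    refine nonpos_of_forall_add_mul_neg (a := -pairing A Z + s * (-1 + σ)) fun n hn => ?_
    have := key (Pi.single m n) 0 0 0 1
      (fun m' => (Pi.single_nonneg.2 hn : (0 : PairIdx K → ℝ) ≤ Pi.single m n) m') le_rfl
      zero_mem_formCone hX0 one_pos
    simp only [Pi.single_apply, ite_mul, zero_mul, Finset.sum_ite_eq', Finset.mem_univ, if_true,
      pairing_zero_left, PEPData.opS] at this
    linarith
  have hA0 : pairing P.Ab0 Z + s * P.c0 ≤ 0 := by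
    refine nonpos_of_forall_add_mul_neg (a := -pairing A Z + s * (-1 + σ)) fun n hn => ?_
    have := key 0 n 0 0 1 (fun _ => le_rfl) hn zero_mem_formCone hX0 one_pos
    simp only [Pi.zero_apply, zero_mul, Finset.sum_const_zero, pairing_zero_left] at this
    linarith
  have hpsd : Z.1.PosSemidef := posSemidef_of_formCone fun k hk => by
    refine neg_nonpos.1 (nonpos_of_forall_add_mul_neg (a := -pairing A Z + s * (-1 + σ)) ?_)
    intro n hn
    have := key 0 0 (n • k) 0 1 (fun _ => le_rfl) le_rfl (smul_mem_formCone hk hn) hX0 one_pos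
    simp only [Pi.zero_apply, zero_mul, Finset.sum_const_zero, pairing_zero_left,
      pairing_smul_left] at this
    linarith
  rcases hs.eq_or_lt with rfl | hs
  · have hZ0 : Z = 0 := P.eq_zero_of_recession hC hZh hpsd hm (by linarith)
    have := key 0 0 0 0 1 (fun _ => le_rfl) le_rfl zero_mem_formCone hX0 one_pos
    simp [hZ0, pairing_comm _ (0 : GramPair K), pairing_zero_left] at this
  · obtain ⟨W, rfl⟩ : ∃ W, Z = s • W := ⟨s⁻¹ • Z, by rw [smul_inv_smul₀ hs.ne']⟩
    have hWpsd : W.1.PosSemidef := by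
      have := hpsd.smul (inv_nonneg.2 hs.le)
      rwa [Prod.smul_fst, inv_smul_smul₀ hs.ne'] at this
    have hW : W ∈ P.supportSet := by
      refine ⟨⟨hWpsd, fun m => ?_⟩, hWpsd, ?_⟩
      · have := hm m
        rw [pairing_smul_right] at this
        exact neg_nonneg.2 (nonpos_of_mul_nonpos_right this hs)
      · rw [pairing_smul_right, ← mul_add] at hA0
        exact nonpos_of_mul_nonpos_right hA0 hs
    obtain ⟨U, hU1, hU2⟩ := exists_dual_unit hDG hDGdiag hDF hDFdiag (W - Zh)
    have hgap := hσ W hW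
    rw [← hU2, pairing_sub_right] at hgap
    have := key 0 0 0 (-(lam • U)) (σ - (pairing A W - lam * (pairing U W - pairing U Zh)))
      (fun _ => le_rfl) le_rfl zero_mem_formCone
      (by
        rw [scaledNorm_neg, scaledNorm_smul, abs_of_nonneg hlam]
        exact (mul_le_of_le_one_right hlam hU1).trans_lt hlam') (by linarith)
    simp only [Pi.zero_apply, zero_mul, Finset.sum_const_zero, pairing_zero_left,
      pairing_smul_left, pairing_neg_left, pairing_smul_right] at this
    linarith

end Conic

/-! ### Transport plans and the worst-case expectation -/

section Transport

open MeasureTheory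

variable {K J N : ℕ}

instance instSecondCountableTopologyMat (n : ℕ) :
    SecondCountableTopology (Matrix (Fin n) (Fin n) ℝ) :=
  inferInstanceAs (SecondCountableTopology (Fin n → Fin n → ℝ))

/-- The loss with parameter `t`. -/
noncomputable def LossData.loss (L : LossData K J) (t : ℝ) (Z : GramPair K) : ℝ :=
  ⨆ j, (pairing (L.Ab j) Z + L.c j * t)

theorem LossData.piece_le_loss (L : LossData K J) (t : ℝ) (Z : GramPair K) (j : Fin J) :
    pairing (L.Ab j) Z + L.c j * t ≤ L.loss t Z :=
  le_ciSup (f := fun j => pairing (L.Ab j) Z + L.c j * t) (Set.finite_range _).bddAbove j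

theorem LossData.continuous_loss [Nonempty (Fin J)] (L : LossData K J) (t : ℝ) :
    Continuous (L.loss t) := by
  unfold LossData.loss
  simp only [← Finset.sup'_univ_eq_ciSup]
  exact Continuous.finset_sup'_apply _
    fun j _ => (continuous_pairing (L.Ab j)).add continuous_const

theorem iInf_lossFamily (L : LossData K J) (Q : Measure (GramPair K)) :
    ⨅ ℓ ∈ lossFamily L, ((∫ Z, ℓ Z ∂Q : ℝ) : EReal) =
      ⨅ t : ℝ, ((∫ Z, L.loss t Z ∂Q : ℝ) : EReal) := by
  have : lossFamily L = Set.range L.loss := by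
    ext ℓ
    exact ⟨fun ⟨t, ht⟩ => ⟨t, funext fun Z => (ht Z).symm⟩, fun ⟨t, ht⟩ => ⟨t, fun Z => ht ▸ rfl⟩⟩
  rw [this, iInf_range]

theorem integrable_of_ae_mem_isCompact {Q : Measure (GramPair K)} [IsFiniteMeasure Q]
    {C : Set (GramPair K)} (hC : IsCompact C) (hQ : ∀ᵐ Z ∂Q, Z ∈ C) {f : GramPair K → ℝ}
    (hf : Continuous f) : Integrable f Q := by
  have := hf.continuousOn.integrableOn_compact (μ := Q) hC
  rwa [IntegrableOn, Measure.restrict_eq_self_of_ae_mem hQ] at this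

theorem integral_empirical (Zhat : Fin N → GramPair K) (S : GramPair K → ℝ) :
    Integrable S (empirical Zhat) ∧
      ∫ z, S z ∂empirical Zhat = (1 / (N : ℝ)) * ∑ i, S (Zhat i) := by
  have hint : ∀ i ∈ Finset.univ, Integrable S (Measure.dirac (Zhat i)) :=
    fun i _ => integrable_dirac enorm_lt_top
  rcases Nat.eq_zero_or_pos N with rfl | hN
  · simp [empirical]
  refine ⟨(integrable_finsetSum_measure.2 hint).smul_measure (by simp; omega), ?_⟩
  rw [empirical, integral_smul_measure, integral_finsetSum_measure hint]
  simp [integral_dirac]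

theorem ae_empirical_mem_range (Zhat : Fin N → GramPair K) :
    ∀ᵐ z ∂empirical Zhat, z ∈ Set.range Zhat := by
  rw [ae_iff]
  simp [empirical, Measure.dirac_apply]

/-- Weak duality: integrating the pointwise bound against a nearly optimal coupling. -/
theorem integral_loss_le_of_coupling [Nonempty (Fin J)] (P : PEPData K)
    (hC : IsCompact P.supportSet)
    {nrm : GramPair K → ℝ} (hcont : Continuous nrm) (hnonneg : ∀ Z, 0 ≤ nrm Z) (L : LossData K J)
    {Zhat : Fin N → GramPair K} {ε : ℝ} (hε : 0 < ε) {Q : Measure (GramPair K)}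
    (hQ : Q ∈ ambiguitySet P nrm Zhat ε) {t lam : ℝ} {s : Fin N → ℝ} (hlam : 0 ≤ lam)
    (hs : ∀ i, ∀ Z ∈ P.supportSet, L.loss t Z ≤ s i - lam * ε + lam * nrm (Zhat i - Z)) :
    ∫ Z, L.loss t Z ∂Q ≤ (1 / (N : ℝ)) * ∑ i, s i := by
  obtain ⟨hprob, hsupp, hW⟩ := hQ
  refine le_of_forall_pos_le_add fun δ hδ => ?_
  set η := δ / (lam + 1) with hη
  have hη0 : 0 < η := by positivity
  have hlt : wasserstein nrm (empirical Zhat) Q < ENNReal.ofReal (ε + η) :=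
    hW.trans_lt ((ENNReal.ofReal_lt_ofReal_iff (by positivity)).2 (by linarith))
  simp only [wasserstein, iInf_lt_iff] at hlt
  obtain ⟨π, ⟨hfst, hsnd⟩, hcost⟩ := hlt
  have : IsProbabilityMeasure π := by
    refine ⟨?_⟩
    have := hprob.measure_univ
    rwa [← hsnd, Measure.map_apply measurable_snd MeasurableSet.univ, Set.preimage_univ] at this
  -- several samples may coincide; the smallest of their bounds is a function of the sample point
  set S : GramPair K → ℝ := fun z => ⨅ i : {i // Zhat i = z}, s i
  have hSle : ∀ i, S (Zhat i) ≤ s i := fun i =>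
    ciInf_le (f := fun k : {k // Zhat k = Zhat i} => s k) (Set.finite_range _).bddBelow ⟨i, rfl⟩
  have hpt : ∀ᵐ p ∂π, L.loss t p.2 ≤ S p.1 - lam * ε + lam * nrm (p.1 - p.2) := by
    have h1 : ∀ᵐ p ∂π, p.1 ∈ Set.range Zhat :=
      ae_of_ae_map measurable_fst.aemeasurable (by rw [hfst]; exact ae_empirical_mem_range Zhat)
    have h2 : ∀ᵐ p ∂π, p.2 ∈ P.supportSet :=
      ae_of_ae_map measurable_snd.aemeasurable (by rw [hsnd]; exact hsupp)
    filter_upwards [h1, h2] with p ⟨i, hi⟩ hp2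
    have : Nonempty {i // Zhat i = p.1} := ⟨⟨i, hi⟩⟩
    have : L.loss t p.2 + lam * ε - lam * nrm (p.1 - p.2) ≤ S p.1 := by
      refine le_ciInf fun k => ?_
      have := hs k p.2 hp2
      rw [k.2] at this
      linarith
    linarith
  have hdist : Continuous fun p : GramPair K × GramPair K => nrm (p.1 - p.2) := by fun_prop
  have hdint : Integrable (fun p : GramPair K × GramPair K => nrm (p.1 - p.2)) π := by
    refine ⟨hdist.measurable.aestronglyMeasurable, ?_⟩
    rw [hasFiniteIntegral_iff_ofReal (ae_of_all _ fun p => hnonneg _)]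
    exact hcost.trans ENNReal.ofReal_lt_top
  have hdle : ∫ p, nrm (p.1 - p.2) ∂π ≤ ε + η := by
    rw [← ofReal_integral_eq_lintegral_ofReal hdint (ae_of_all _ fun p => hnonneg _)] at hcost
    exact ((ENNReal.ofReal_lt_ofReal_iff (by positivity)).1 hcost).le
  obtain ⟨hSint, hSeq⟩ := integral_empirical Zhat S
  rw [← hfst] at hSint hSeq
  have hSint' : Integrable (fun p : GramPair K × GramPair K => S p.1) π :=
    hSint.comp_measurable measurable_fst
  rw [integral_map measurable_fst.aemeasurable hSint.1] at hSeq
  have hLint := integrable_of_ae_mem_isCompact hC hsupp (L.continuous_loss t)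
  rw [← hsnd] at hLint ⊢
  rw [integral_map measurable_snd.aemeasurable hLint.1]
  have hsub : Integrable (fun p : GramPair K × GramPair K => S p.1 - lam * ε) π :=
    hSint'.sub (integrable_const _)
  calc ∫ p, L.loss t p.2 ∂π
      ≤ ∫ p, (S p.1 - lam * ε + lam * nrm (p.1 - p.2)) ∂π :=
        integral_mono_ae (hLint.comp_measurable measurable_snd)
          (hsub.add (hdint.const_mul lam)) hpt
    _ = (1 / (N : ℝ)) * ∑ i, S (Zhat i) - lam * ε + lam * ∫ p, nrm (p.1 - p.2) ∂π := by
        rw [integral_add hsub (hdint.const_mul lam), integral_sub hSint' (integrable_const _),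
          hSeq]
        simp [integral_const_mul]
    _ ≤ (1 / (N : ℝ)) * ∑ i, s i - lam * ε + lam * (ε + η) := by
        gcongr with i
        exact hSle i
    _ ≤ (1 / (N : ℝ)) * ∑ i, s i + δ := by
        have : lam * η ≤ δ := by
          rw [hη, mul_div_assoc', div_le_iff₀ (by positivity)]
          nlinarith
        linarith

/-- The triples `(a, d, v)` for which some probability distribution on the support set has mean
distance at most `d` from `z` and expected loss at least `v + a t`, for every `t`. -/
def attainable (P : PEPData K) (nrm : GramPair K → ℝ) (L : LossData K J) (z : GramPair K) :
    Set (ℝ × ℝ × ℝ) :=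
  {u | ∃ Q : Measure (GramPair K), IsProbabilityMeasure Q ∧ (∀ᵐ Z ∂Q, Z ∈ P.supportSet) ∧
    ∫ Z, nrm (z - Z) ∂Q ≤ u.2.1 ∧ ∀ t, u.2.2 + u.1 * t ≤ ∫ Z, L.loss t Z ∂Q}

/-- The triples `(c_obj^j, ‖z - Z‖, ⟨(A_obj^j, b_obj^j), Z⟩)` for a piece `j` and a point `Z` of
the support set. -/
def pieceSet (P : PEPData K) (nrm : GramPair K → ℝ) (L : LossData K J) (z : GramPair K) :
    Set (ℝ × ℝ × ℝ) :=
  ⋃ j, (fun Z => (L.c j, nrm (z - Z), pairing (L.Ab j) Z)) '' P.supportSet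

theorem isCompact_pieceSet (P : PEPData K) (hC : IsCompact P.supportSet) {nrm : GramPair K → ℝ}
    (hcont : Continuous nrm) (L : LossData K J) (z : GramPair K) :
    IsCompact (pieceSet P nrm L z) := by
  refine isCompact_iUnion fun j => hC.image ?_
  have := continuous_pairing (L.Ab j)
  fun_prop

theorem pieceSet_subset_attainable (P : PEPData K) (nrm : GramPair K → ℝ) (L : LossData K J)
    (z : GramPair K) : pieceSet P nrm L z ⊆ attainable P nrm L z := by
  rintro _ ⟨_, ⟨j, rfl⟩, Z, hZ, rfl⟩
  refine ⟨Measure.dirac Z, inferInstance, ?_, by simp [integral_dirac], fun t => ?_⟩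
  · rw [ae_dirac_eq]
    exact hZ
  · simpa [integral_dirac] using L.piece_le_loss t Z j

theorem convex_attainable [Nonempty (Fin J)] (P : PEPData K) (hC : IsCompact P.supportSet)
    {nrm : GramPair K → ℝ} (hcont : Continuous nrm) (L : LossData K J) (z : GramPair K) :
    Convex ℝ (attainable P nrm L z) := by
  rintro u ⟨Q, hQ, hQs, hQd, hQv⟩ w ⟨Q', hQ', hQs', hQd', hQv'⟩ a b ha hb hab
  have hint : ∀ f : GramPair K → ℝ, Continuous f →
      ∫ Z, f Z ∂(ENNReal.ofReal a • Q + ENNReal.ofReal b • Q') =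
        a * ∫ Z, f Z ∂Q + b * ∫ Z, f Z ∂Q' := fun f hf => by
    rw [integral_add_measure
      ((integrable_of_ae_mem_isCompact hC hQs hf).smul_measure ENNReal.ofReal_ne_top)
      ((integrable_of_ae_mem_isCompact hC hQs' hf).smul_measure ENNReal.ofReal_ne_top),
      integral_smul_measure, integral_smul_measure, ENNReal.toReal_ofReal ha,
      ENNReal.toReal_ofReal hb, smul_eq_mul, smul_eq_mul]
  refine ⟨ENNReal.ofReal a • Q + ENNReal.ofReal b • Q', ⟨?_⟩, ?_, ?_, fun t => ?_⟩
  · simp [← ENNReal.ofReal_add ha hb, hab]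
  · exact ae_add_measure_iff.2 ⟨Measure.ae_smul_measure hQs _, Measure.ae_smul_measure hQs' _⟩
  · rw [hint _ (by fun_prop)]
    simp only [Prod.snd_add, Prod.fst_add, Prod.smul_snd, Prod.smul_fst, smul_eq_mul]
    gcongr
  · rw [hint _ (L.continuous_loss t)]
    simp only [Prod.snd_add, Prod.fst_add, Prod.smul_snd, Prod.smul_fst, smul_eq_mul]
    have h1 := mul_le_mul_of_nonneg_left (hQv t) ha
    have h2 := mul_le_mul_of_nonneg_left (hQv' t) hb
    linarith

/-- Distributions attached to the samples are averaged to a distribution in the ambiguity set. -/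
theorem exists_mem_ambiguitySet [Nonempty (Fin J)] (hN : 0 < N) (P : PEPData K)
    (hC : IsCompact P.supportSet) {nrm : GramPair K → ℝ} (hcont : Continuous nrm)
    (hnonneg : ∀ Z, 0 ≤ nrm Z) (L : LossData K J) {Zhat : Fin N → GramPair K} {ε r : ℝ}
    {u : Fin N → ℝ × ℝ × ℝ} (hu : ∀ i, u i ∈ attainable P nrm L (Zhat i))
    (h1 : ∑ i, (u i).1 = 0) (h2 : (1 / (N : ℝ)) * ∑ i, (u i).2.1 ≤ ε)
    (h3 : r ≤ (1 / (N : ℝ)) * ∑ i, (u i).2.2) :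
    ∃ Q ∈ ambiguitySet P nrm Zhat ε, ∀ t, r ≤ ∫ Z, L.loss t Z ∂Q := by
  choose Q hQ hQs hQd hQv using hu
  have hN0 : (N : ℝ≥0∞) ≠ 0 := by simpa using hN.ne'
  refine ⟨(N : ℝ≥0∞)⁻¹ • ∑ i, Q i, ⟨⟨?_⟩, ?_, ?_⟩, fun t => ?_⟩
  · simp [ENNReal.inv_mul_cancel hN0]
  · refine Measure.ae_smul_measure ?_ _
    rw [← Measure.sum_fintype]
    exact Measure.ae_sum_iff.2 hQs
  · have hmeas : ∀ i, Measurable fun Z : GramPair K => (Zhat i, Z) := fun i => by fun_prop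
    have hdist : Continuous fun p : GramPair K × GramPair K => nrm (p.1 - p.2) := by fun_prop
    have hcoup : (N : ℝ≥0∞)⁻¹ • ∑ i, (Q i).map (fun Z => (Zhat i, Z)) ∈
        couplings (empirical Zhat) ((N : ℝ≥0∞)⁻¹ • ∑ i, Q i) := by
      constructor
      · rw [Measure.map_smul, Measure.map_finset_sum measurable_fst.aemeasurable, empirical]
        simp only [Measure.map_map measurable_fst (hmeas _), Function.comp_def, Measure.map_const,
          measure_univ, one_smul]
      · rw [Measure.map_smul, Measure.map_finset_sum measurable_snd.aemeasurable]
        simp only [Measure.map_map measurable_snd (hmeas _), Function.comp_def, Measure.map_id']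
    refine (iInf₂_le _ hcoup).trans ?_
    rw [lintegral_smul_measure, lintegral_finsetSum_measure]
    have : ∀ i, ∫⁻ p, ENNReal.ofReal (nrm (p.1 - p.2)) ∂(Q i).map (fun Z => (Zhat i, Z)) =
        ENNReal.ofReal (∫ Z, nrm (Zhat i - Z) ∂Q i) := fun i => by
      rw [lintegral_map hdist.measurable.ennreal_ofReal (hmeas i),
        ofReal_integral_eq_lintegral_ofReal
          (integrable_of_ae_mem_isCompact hC (hQs i) (by fun_prop))
          (ae_of_all _ fun Z => hnonneg _)]
    simp only [this]
    rw [← ENNReal.ofReal_sum_of_nonneg fun i _ => integral_nonneg fun Z => hnonneg _,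
      smul_eq_mul, ← ENNReal.ofReal_natCast, ← ENNReal.ofReal_inv_of_pos (by exact_mod_cast hN),
      ← ENNReal.ofReal_mul (by positivity), ← one_div]
    refine ENNReal.ofReal_le_ofReal (le_trans ?_ h2)
    gcongr with i
    exact hQd i
  · rw [integral_smul_measure, integral_finsetSum_measure fun i _ =>
      integrable_of_ae_mem_isCompact hC (hQs i) (L.continuous_loss t)]
    have := Finset.sum_le_sum fun i (_ : i ∈ Finset.univ) => hQv i t
    rw [Finset.sum_add_distrib, ← Finset.sum_mul, h1, zero_mul, add_zero] at this
    refine h3.trans ?_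
    rw [ENNReal.toReal_inv, ENNReal.toReal_natCast, smul_eq_mul, ← one_div]
    gcongr

end Transport

/-! ### Lagrangian duality for the transport problem -/

/-- Carathéodory's theorem bounds the number of points in a convex combination, so that the convex
hull is a continuous image of a product of compact sets. -/
theorem isCompact_convexHull_of_isCompact {E : Type*} [NormedAddCommGroup E] [NormedSpace ℝ E]
    [FiniteDimensional ℝ E] {s : Set E} (hs : IsCompact s) : IsCompact (convexHull ℝ s) := by
  rcases s.eq_empty_or_nonempty with rfl | ⟨x₀, hx₀⟩
  · simp
  set n := Module.finrank ℝ E + 1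
  have hK : IsCompact (stdSimplex ℝ (Fin n) ×ˢ Set.univ.pi fun _ : Fin n => s) :=
    (isCompact_stdSimplex ℝ _).prod (isCompact_univ_pi fun _ => hs)
  convert hK.image (f := fun p : (Fin n → ℝ) × (Fin n → E) => ∑ i, p.1 i • p.2 i) (by fun_prop)
    using 1
  refine Set.Subset.antisymm (fun x hx => ?_) ?_
  · obtain ⟨ι, _, z, w, hz, hind, hw0, hw1, rfl⟩ := eq_pos_convex_span_of_mem_convexHull hx
    have hcard : Fintype.card ι ≤ Fintype.card (Fin n) := by
      simpa [n] using hind.card_le_finrank_succ.trans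
        (Nat.succ_le_succ (Submodule.finrank_le _))
    obtain ⟨e⟩ := Function.Embedding.nonempty_of_card_le hcard
    refine ⟨(Function.extend e w 0, Function.extend e z fun _ => x₀), ⟨⟨fun i => ?_, ?_⟩,
      fun i _ => ?_⟩, ?_⟩
    · by_cases h : ∃ k, e k = i
      · obtain ⟨k, rfl⟩ := h
        simpa [e.injective.extend_apply] using (hw0 k).le
      · simp [Function.extend_apply' _ _ _ h]
    · rw [← hw1]
      refine (Fintype.sum_of_injective e e.injective _ _ (fun i hi => ?_) fun k => ?_).symm
      · exact Function.extend_apply' _ _ _ hi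
      · simp [e.injective.extend_apply]
    · by_cases h : ∃ k, e k = i
      · obtain ⟨k, rfl⟩ := h
        simpa [e.injective.extend_apply] using hz ⟨k, rfl⟩
      · simpa [Function.extend_apply' _ _ _ h] using hx₀
    · refine (Fintype.sum_of_injective e e.injective _ _ (fun i hi => ?_) fun k => ?_).symm
      · simp [Function.extend_apply' _ _ _ hi]
      · simp [e.injective.extend_apply]
  · rintro _ ⟨p, ⟨hp, hz⟩, rfl⟩
    exact (convex_convexHull ℝ s).sum_mem (fun i _ => hp.1 i) hp.2
      fun i _ => subset_convexHull ℝ s (hz i trivial)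

/-- Lagrangian duality for the maximization of `v` over the points `(a, d, v)` of a compact convex
set with `a = 0` and `d ≤ ε`. Compactness replaces a constraint qualification: the multiplier of `v`
can be made positive by a small perturbation. -/
theorem exists_lagrange_multipliers {T : Set (ℝ × ℝ × ℝ)} (hT : IsCompact T) (hconv : Convex ℝ T)
    {ε r : ℝ} (h : ∀ u ∈ T, u.1 = 0 → u.2.1 ≤ ε → u.2.2 < r) :
    ∃ t lam : ℝ, 0 ≤ lam ∧ ∀ u ∈ T, t * u.1 - lam * u.2.1 + u.2.2 < r - lam * ε := by
  have hB : Convex ℝ (({0} : Set ℝ) ×ˢ (Set.Iic ε ×ˢ Set.Ici r)) :=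
    (convex_singleton 0).prod ((convex_Iic ε).prod (convex_Ici r))
  have hBc : IsClosed (({0} : Set ℝ) ×ˢ (Set.Iic ε ×ˢ Set.Ici r)) :=
    isClosed_singleton.prod (isClosed_Iic.prod isClosed_Ici)
  obtain ⟨f, p, q, hfp, hpq, hfq⟩ := geometric_hahn_banach_compact_closed hconv hT hB hBc
    (Set.disjoint_left.2 fun u hu ⟨h1, h2, h3⟩ => (h u hu h1 h2).not_ge h3)
  obtain ⟨a, ha⟩ : ∃ a, f (1, 0, 0) = a := ⟨_, rfl⟩
  obtain ⟨b, hb⟩ : ∃ b, f (0, 1, 0) = b := ⟨_, rfl⟩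
  obtain ⟨c, hc⟩ : ∃ c, f (0, 0, 1) = c := ⟨_, rfl⟩
  have hf : ∀ u : ℝ × ℝ × ℝ, f u = a * u.1 + b * u.2.1 + c * u.2.2 := fun u => by
    have : u = u.1 • ((1, 0, 0) : ℝ × ℝ × ℝ) + u.2.1 • ((0, 1, 0) : ℝ × ℝ × ℝ)
        + u.2.2 • ((0, 0, 1) : ℝ × ℝ × ℝ) := by ext <;> simp
    conv_lhs => rw [this]
    simp only [map_add, map_smul, ha, hb, hc, smul_eq_mul]
    ring
  have hq : ∀ d v : ℝ, d ≤ ε → r ≤ v → q < b * d + c * v := fun d v hd hv => by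
    have := hfq (0, d, v) ⟨rfl, hd, hv⟩
    rw [hf] at this
    simpa using this
  have hb0 : b ≤ 0 := nonpos_of_forall_add_mul_neg (a := q - b * ε - c * r) fun n hn => by
    have := hq (ε - n) r (by linarith) le_rfl
    linarith
  have hc0 : 0 ≤ c := neg_nonpos.1 <|
    nonpos_of_forall_add_mul_neg (a := q - b * ε - c * r) fun n hn => by
      have := hq ε (r + n) le_rfl (by linarith)
      linarith
  obtain ⟨M, hM⟩ := hT.bddAbove_image (f := fun u : ℝ × ℝ × ℝ => u.2.2) (by fun_prop)
  set g := c + (q - p) / (|M - r| + 1) with hg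
  have hη : 0 < (q - p) / (|M - r| + 1) := div_pos (sub_pos.2 hpq) (by positivity)
  have hg0 : 0 < g := by linarith
  have hηM : (q - p) / (|M - r| + 1) * (M - r) ≤ q - p := by
    rw [div_mul_eq_mul_div, div_le_iff₀ (by positivity)]
    exact mul_le_mul_of_nonneg_left (by linarith [le_abs_self (M - r)]) (sub_pos.2 hpq).le
  refine ⟨a / g, -b / g, div_nonneg (neg_nonneg.2 hb0) hg0.le, fun u hu => ?_⟩
  have h1 := hfp u hu
  rw [hf] at h1
  have h2 := hq ε r le_rfl le_rfl
  have h3 := mul_le_mul_of_nonneg_left (hM ⟨u, hu, rfl⟩ : u.2.2 ≤ M) hη.le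
  have h4 : a * u.1 + b * u.2.1 + g * u.2.2 < g * r + b * ε := by
    rw [hg, add_mul, add_mul]
    linarith
  have h5 : a / g * u.1 - -b / g * u.2.1 + u.2.2 = (a * u.1 + b * u.2.1 + g * u.2.2) / g := by
    field_simp
    ring
  have h6 : r - -b / g * ε = (g * r + b * ε) / g := by
    field_simp
    ring
  rw [h5, h6]
  exact div_lt_div_of_pos_right h4 hg0

/-! ### The minimization problem -/

section Program

variable {K J N : ℕ} {DG : Matrix (Fin (K + 2)) (Fin (K + 2)) ℝ}
    {DF : Matrix (Fin (K + 1)) (Fin (K + 1)) ℝ}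

theorem convex_feasibleSet (DG : Matrix (Fin (K + 2)) (Fin (K + 2)) ℝ)
    (DF : Matrix (Fin (K + 1)) (Fin (K + 1)) ℝ) (P : PEPData K) (L : LossData K J)
    (Zhat : Fin N → GramPair K) (ε : ℝ) :
    Convex ℝ (feasibleSet P (scaledNorm DG DF) L Zhat ε) := by
  rintro ⟨s, t, τ, X, lam, y⟩ hv ⟨s', t', τ', X', lam', y'⟩ hv' a b ha hb hab
  simp only [feasibleSet, Set.mem_ofPred_eq] at hv hv'
  have hdual : ∀ i j, -P.opSadj ((a • y + b • y') i j) - (a • X + b • X') i j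
      + (a • τ + b • τ') i j • P.Ab0 - L.Ab j =
      a • (-P.opSadj (y i j) - X i j + τ i j • P.Ab0 - L.Ab j)
        + b • (-P.opSadj (y' i j) - X' i j + τ' i j • P.Ab0 - L.Ab j) := fun i j => by
    obtain rfl : b = 1 - a := by linarith
    simp only [Pi.add_apply, Pi.smul_apply, P.opSadj_add, P.opSadj_smul, smul_eq_mul]
    module
  refine IsFeasible.mk (fun i j => ?_) (fun i j => ?_) ?_ (fun i j m => ?_) (fun i j => ?_)
    (fun i j => ?_) (fun i j => ?_) fun i j => ?_
  · exact add_nonneg (mul_nonneg ha (hv.tau_nonneg i j)) (mul_nonneg hb (hv'.tau_nonneg i j))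
  · exact ((hv.XY_symm i j).smul a).add ((hv'.XY_symm i j).smul b)
  · exact add_nonneg (mul_nonneg ha hv.lam_nonneg) (mul_nonneg hb hv'.lam_nonneg)
  · exact add_nonneg (mul_nonneg ha (hv.y_nonneg i j m)) (mul_nonneg hb (hv'.y_nonneg i j m))
  · have h1 := mul_le_mul_of_nonneg_left (hv.epigraph i j) ha
    have h2 := mul_le_mul_of_nonneg_left (hv'.epigraph i j) hb
    simp only [Prod.smul_mk, Prod.mk_add_mk, Pi.add_apply, Pi.smul_apply, smul_eq_mul,
      pairing_add_left, pairing_smul_left]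
    linarith
  · simp only [Prod.smul_mk, Prod.mk_add_mk]
    rw [hdual]
    exact ((hv.psd i j).smul ha).add ((hv'.psd i j).smul hb)
  · simp only [Prod.smul_mk, Prod.mk_add_mk]
    rw [hdual, Prod.snd_add, Prod.smul_snd, Prod.smul_snd, hv.eq_zero i j, hv'.eq_zero i j]
    simp
  · exact convex_scaledNorm_epigraph DG DF (x := (X i j, lam)) (hv.norm_le i j)
      (y := (X' i j, lam')) (hv'.norm_le i j) ha hb hab

/-- Weak duality: every feasible point bounds the worst-case expectation. -/
theorem worstCaseExpectation_le_droPepValue (hJ : 0 < J) (P : PEPData K) (L : LossData K J)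
    (hC : IsCompact P.supportSet) (Zhat : Fin N → GramPair K)
    (hDG : DG.PosDef) (hDGdiag : DG.IsDiag) (hDF : DF.PosDef) (hDFdiag : DF.IsDiag)
    {ε : ℝ} (hε : 0 < ε) :
    worstCaseExpectation P (scaledNorm DG DF) L Zhat ε ≤
      droPepValue P (scaledNorm DG⁻¹ DF⁻¹) L Zhat ε := by
  have : Nonempty (Fin J) := ⟨⟨0, hJ⟩⟩
  refine iSup₂_le fun Q hQ => le_iInf₂ fun ⟨s, t, τ, X, lam, y⟩ hv => ?_
  simp only [feasibleSet, Set.mem_ofPred_eq] at hv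
  rw [iInf_lossFamily]
  refine (iInf_le _ t).trans (EReal.coe_le_coe_iff.2 ?_)
  refine integral_loss_le_of_coupling P hC (continuous_scaledNorm DG DF)
    (scaledNorm_nonneg DG DF) L hε hQ hv.lam_nonneg fun i Z hZ => ciSup_le fun j => ?_
  have hX : pairing (X i j) (Zhat i - Z) ≤ lam * scaledNorm DG DF (Zhat i - Z) :=
    (pairing_le_scaledNorm_mul hDG hDGdiag hDF hDFdiag _ _).trans
      (mul_le_mul_of_nonneg_right (hv.norm_le i j) (scaledNorm_nonneg _ _ _))
  have h1 := pairing_le_of_multipliers P hZ (hv.tau_nonneg i j) (hv.y_nonneg i j) (hv.psd i j)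
    (hv.eq_zero i j) hX
  have h2 := hv.epigraph i j
  linarith

/-- Strong duality: a level that no distribution of the ambiguity set guarantees for all `t` is not
exceeded by the value of the minimization problem. -/
theorem exists_feasible_objective_le (hJ : 0 < J) (hN : 0 < N) (P : PEPData K)
    (L : LossData K J) (hC : IsCompact P.supportSet) {Zhat : Fin N → GramPair K}
    (hZhat : ∀ i, Zhat i ∈ P.supportSet)
    (hDG : DG.PosDef) (hDGdiag : DG.IsDiag) (hDF : DF.PosDef) (hDFdiag : DF.IsDiag)
    {ε : ℝ} (hε : 0 < ε) {r : ℝ}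
    (hr : ∀ Q ∈ ambiguitySet P (scaledNorm DG DF) Zhat ε, ∃ t, ∫ Z, L.loss t Z ∂Q < r) :
    ∃ v ∈ feasibleSet P (scaledNorm DG⁻¹ DF⁻¹) L Zhat ε, objective v ≤ r := by
  have : Nonempty (Fin J) := ⟨⟨0, hJ⟩⟩
  have hcont := continuous_scaledNorm DG DF
  set piece : Fin N → Set (ℝ × ℝ × ℝ) := fun i => pieceSet P (scaledNorm DG DF) L (Zhat i)
  have hpiece : ∀ i, IsCompact (piece i) := fun i => isCompact_pieceSet P hC hcont L (Zhat i)
  set avg : (Fin N → ℝ × ℝ × ℝ) →ₗ[ℝ] ℝ × ℝ × ℝ :=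
    (1 / (N : ℝ)) • ∑ i, LinearMap.proj i with havg
  have h1 : ∀ u, (avg u).1 = (1 / (N : ℝ)) * ∑ i, (u i).1 := fun u => by
    simp [havg, Prod.fst_sum]
  have h2 : ∀ u, (avg u).2.1 = (1 / (N : ℝ)) * ∑ i, (u i).2.1 := fun u => by
    simp [havg, Prod.fst_sum, Prod.snd_sum]
  have h3 : ∀ u, (avg u).2.2 = (1 / (N : ℝ)) * ∑ i, (u i).2.2 := fun u => by
    simp [havg, Prod.snd_sum]
  set U : Set (Fin N → ℝ × ℝ × ℝ) := Set.univ.pi fun i => convexHull ℝ (piece i)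
  have hUc : IsCompact U :=
    isCompact_univ_pi fun i => isCompact_convexHull_of_isCompact (hpiece i)
  have hUconv : Convex ℝ U := convex_pi fun i _ => convex_convexHull ℝ _
  obtain ⟨t, lam, hlam, hT⟩ := exists_lagrange_multipliers
    (hUc.image avg.continuous_of_finiteDimensional) (hUconv.linear_image avg) (ε := ε) (r := r) (by
      rintro _ ⟨u, hu, rfl⟩ hu1 hu2
      by_contra! hu3
      rw [h1, mul_eq_zero, or_iff_right (by positivity)] at hu1
      obtain ⟨Q, hQ, hQr⟩ := exists_mem_ambiguitySet hN P hC hcont (scaledNorm_nonneg DG DF) L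
        (u := u) (Zhat := Zhat) (fun i => convexHull_min
          (pieceSet_subset_attainable P _ L (Zhat i)) (convex_attainable P hC hcont L (Zhat i))
          (hu i trivial)) hu1 (h2 u ▸ hu2) (h3 u ▸ hu3)
      obtain ⟨t, ht⟩ := hr Q hQ
      exact (hQr t).not_gt ht)
  have hne : ∀ i, (piece i).Nonempty := fun i =>
    ⟨_, Set.mem_iUnion.2 ⟨⟨0, hJ⟩, Set.mem_image_of_mem _ (hZhat i)⟩⟩
  choose u hu humax using fun i => (hpiece i).exists_isMaxOn (hne i)
    (f := fun w : ℝ × ℝ × ℝ => t * w.1 - lam * w.2.1 + w.2.2) (by fun_prop)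
  set m : Fin N → ℝ := fun i => t * (u i).1 - lam * (u i).2.1 + (u i).2.2
  have hm : (1 / (N : ℝ)) * ∑ i, m i < r - lam * ε := by
    have := hT (avg u) ⟨u, fun i _ => subset_convexHull ℝ _ (hu i), rfl⟩
    rw [h1, h2, h3] at this
    simp only [m, Finset.sum_add_distrib, Finset.sum_sub_distrib, ← Finset.mul_sum]
    linarith
  -- the slack is spent on relaxing `lam` to `lam + δ` and the conic inequalities by `δ`
  set δ := (r - lam * ε - (1 / (N : ℝ)) * ∑ i, m i) / (1 + ε)
  have hδ0 : 0 < δ := div_pos (by linarith) (by linarith)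
  have hmax : ∀ i j, ∀ Z ∈ P.supportSet,
      pairing (L.Ab j) Z - lam * scaledNorm DG DF (Z - Zhat i) < m i + δ - L.c j * t := by
    intro i j Z hZ
    have : t * L.c j - lam * scaledNorm DG DF (Zhat i - Z) + pairing (L.Ab j) Z ≤ m i :=
      humax i (Set.mem_iUnion.2 ⟨j, Set.mem_image_of_mem _ hZ⟩)
    rw [← scaledNorm_neg, neg_sub]
    linarith
  choose X y τ hXs hτ hy hpsd hzero hX hle using fun i j =>
    exists_multipliers hDG hDGdiag hDF hDFdiag P hC (hZhat i) (L.Ab_symm j) hlam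
      (lt_add_of_pos_right lam hδ0) (hmax i j)
  refine ⟨(fun i => m i + (δ + (lam + δ) * ε), t, τ, X, lam + δ, y),
    IsFeasible.mk hτ hXs (by linarith) hy (fun i j => ?_) hpsd hzero hX, le_of_eq ?_⟩
  · have := hle i j
    simp only
    linarith
  · have hN' : (N : ℝ) ≠ 0 := by positivity
    have hδ' : δ * (1 + ε) = r - lam * ε - (1 / (N : ℝ)) * ∑ i, m i :=
      div_mul_cancel₀ _ (by positivity)
    simp only [objective, Finset.sum_add_distrib, Finset.sum_const, Finset.card_univ,
      Fintype.card_fin, nsmul_eq_mul]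
    rw [mul_add, ← mul_add (N : ℝ), ← mul_assoc (1 / (N : ℝ)) (N : ℝ), one_div_mul_cancel hN',
      one_mul]
    linarith

end Program

end DroPep

theorem mainTheorem6 (K J N : ℕ) (hJ : 0 < J) (hN : 0 < N)
    (P : DroPep.PEPData K) (L : DroPep.LossData K J)
    (hcompact : IsCompact P.supportSet)
    (Zhat : Fin N → DroPep.GramPair K) (hZhat : ∀ i, Zhat i ∈ P.supportSet)
    (DG : Matrix (Fin (K + 2)) (Fin (K + 2)) ℝ) (hDG : DG.PosDef) (hDGdiag : DG.IsDiag)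
    (DF : Matrix (Fin (K + 1)) (Fin (K + 1)) ℝ) (hDF : DF.PosDef) (hDFdiag : DF.IsDiag)
    (ε : ℝ) (hε : 0 < ε) :
    -- the worst-case expectation over the `‖·‖_D`-Wasserstein ball is the optimal value of the
    -- minimization problem with the norm `‖·‖_{D⁻¹}` in its norm constraint
    DroPep.worstCaseExpectation P (DroPep.scaledNorm DG DF) L Zhat ε =
      DroPep.droPepValue P (DroPep.scaledNorm DG⁻¹ DF⁻¹) L Zhat ε ∧
    -- this problem is convex: its feasible set is convex and its objective is affine
    Convex ℝ (DroPep.feasibleSet P (DroPep.scaledNorm DG⁻¹ DF⁻¹) L Zhat ε) ∧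
    -- `‖·‖_{D⁻¹}` is the dual norm of `‖·‖_D`
    (∀ U : DroPep.GramPair K, U.1.IsSymm →
      IsLUB {r : ℝ | ∃ Z : DroPep.GramPair K, Z.1.IsSymm ∧ DroPep.scaledNorm DG DF Z ≤ 1 ∧
          r = DroPep.pairing U Z}
        (DroPep.scaledNorm DG⁻¹ DF⁻¹ U)) := by
  refine ⟨le_antisymm ?_ ?_, DroPep.convex_feasibleSet _ _ P L Zhat ε,
    fun U hU => DroPep.isLUB_pairing hDG hDGdiag hDF hDFdiag hU⟩
  · exact DroPep.worstCaseExpectation_le_droPepValue hJ P L hcompact Zhat hDG hDGdiag hDF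
      hDFdiag hε
  · refine EReal.le_of_forall_lt_iff_le.1 fun r hr => ?_
    obtain ⟨v, hv, hvr⟩ := DroPep.exists_feasible_objective_le hJ hN P L hcompact hZhat hDG
      hDGdiag hDF hDFdiag hε (r := r) fun Q hQ => by
        have h := (le_iSup₂ (f := fun Q (_ : Q ∈ DroPep.ambiguitySet P
          (DroPep.scaledNorm DG DF) Zhat ε) => ⨅ ℓ ∈ DroPep.lossFamily L,
            ((∫ Z, ℓ Z ∂Q : ℝ) : EReal)) Q hQ).trans_lt hr
        rw [DroPep.iInf_lossFamily] at h
        obtain ⟨t, ht⟩ := iInf_lt_iff.1 h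
        exact ⟨t, EReal.coe_lt_coe_iff.1 ht⟩
    exact (iInf₂_le v hv).trans (EReal.coe_le_coe_iff.2 hvr)
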